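/- Let $X$ be a smooth quasi-affine algebraic variety over $\mathbb{C}$ (not necessarily irreducible). A one-parameter unipotent subgroup of $\operatorname{Aut}(X)$ is given by an algebraic action $U:\mathbb{C}\times X\to X$, $(t,x)\mapsto U_t(x)$, of the additive group $(\mathbb{C},+)$. Call $X$ flexible if for every $x\in X$ the tangent space $T_xX$ is spanned by the tangent vectors at $x$ to the orbits through $x$ of the one-parameter unipotent subgroups of $\operatorname{Aut}(X)$. A derivation $\sigma$ of $\mathbb{C}[X]$ (a vector field on $X$) is locally nilpotent if every $f\in\mathbb{C}[X]$ satisfies $\sigma^n(f)=0$ for some $n$; an algebraic action $U$ of $(\mathbb{C},+)$ is its flow if $f\circ U_t=\sum_{n\ge 0}\frac{t^n}{n!}\sigma^n(f)$ for all $f\in\mathbb{C}[X]$. An algebraic spray on $X$ is an algebraic vector bundle $p:E\to X$ with a morphism $s:E\to X$ such that $s(0_x)=x$ for every $x\in X$, where $0_x$ is the zero of the fibre $E_x=p^{-1}(x)$. It is dominating if $ds(T_{0_x}E_x)=T_xX$ for every $x\in X$. Call $X$ algebraically elliptic if it admits a dominating algebraic spray. **Theorem.** Every flexible smooth quasi-affine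 algebraic variety $X$ over $\mathbb{C}$ is algebraically elliptic. More precisely, there are finitely many locally nilpotent vector fields $\sigma_1,\dots,\sigma_l$ on $X$, each having a flow $U^i$ which is an algebraic action of $(\mathbb{C},+)$ on $X$, such that the values $\sigma_1(x),\dots,\sigma_l(x)$ span $T_xX$ at every $x\in X$, and such that the trivial bundle $X\times\mathbb{C}^l\to X$ together with $$s(x,t_1,\dots,t_l)=U^1_{t_1}\circ\cdots\circ U^l_{t_l}(x)$$ is a dominating algebraic spray on $X$. -/

import Mathlib

open CategoryTheory AlgebraicGeometry

noncomputable section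

namespace AlgSpray

/-- The base scheme `Spec ℂ`. -/
abbrev SpecC : Scheme.{0} := Spec (CommRingCat.of ℂ)

/-! ### Complex points, constants and Zariski tangent spaces -/

/-- The complex points of a scheme over `ℂ`. When `X` is locally of finite type over `ℂ` these
are the closed points of `X`, that is, the points of the complex algebraic variety `X`. -/
def CPoint (X : Scheme.{0}) [X.Over SpecC] : Type :=
  { a : SpecC ⟶ X // a ≫ (X ↘ SpecC) = 𝟙 SpecC }

/-- The constant regular functions on a scheme over `ℂ`. -/
def constants (X : Scheme.{0}) [X.Over SpecC] : ℂ →+* Γ(X, ⊤) :=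
  ((Scheme.ΓSpecIso (CommRingCat.of ℂ)).inv ≫ (X ↘ SpecC).appTop).hom

/-- The ring of global regular functions on a scheme over `ℂ` is a `ℂ`-algebra. -/
instance globalAlgebra (X : Scheme.{0}) [X.Over SpecC] : Algebra ℂ Γ(X, ⊤) :=
  (constants X).toAlgebra

lemma stalkClosedPointTo_congr {Z : Scheme.{0}} {c c' : SpecC ⟶ Z} (h : c = c')
    (hs : c (IsLocalRing.closedPoint ℂ) ⤳ c' (IsLocalRing.closedPoint ℂ)) :
    Z.presheaf.stalkSpecializes hs ≫ Scheme.stalkClosedPointTo c =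
      Scheme.stalkClosedPointTo c' := by
  subst h
  rw [TopCat.Presheaf.stalkSpecializes_refl, Category.id_comp]

section Tangent

variable {X Y : Scheme.{0}} [X.Over SpecC] [Y.Over SpecC]

/-- The underlying point of the scheme. -/
abbrev CPoint.pt (a : CPoint X) : X := a.1 (IsLocalRing.closedPoint ℂ)

/-- The local ring of `X` at a complex point. -/
abbrev CPoint.localRing (a : CPoint X) : CommRingCat := X.presheaf.stalk a.pt

/-- The germ at `a` of a global regular function. -/
def CPoint.germ (a : CPoint X) : Γ(X, ⊤) →+* a.localRing :=
  (X.presheaf.germ ⊤ a.pt (TopologicalSpace.Opens.mem_top _)).hom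

/-- The value at `a` of a germ of a regular function at `a`. -/
def CPoint.eval (a : CPoint X) : a.localRing →+* ℂ :=
  (Scheme.stalkClosedPointTo a.1).hom

/-- The tangent space `T_a X`: the complex vector space of `ℂ`-linear derivations
`𝒪_{X,a} → ℂ`, where `𝒪_{X,a}` acts on `ℂ` through evaluation at `a`. -/
def TangentSpace (a : CPoint X) : Submodule ℂ (a.localRing → ℂ) where
  carrier := { D | (∀ f g, D (f + g) = D f + D g) ∧
    (∀ f g, D (f * g) = a.eval f * D g + a.eval g * D f) ∧
    ∀ c : ℂ, D (a.germ (constants X c)) = 0 }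
  add_mem' := by
    rintro D D' ⟨h₁, h₂, h₃⟩ ⟨h₁', h₂', h₃'⟩
    refine ⟨fun f g => ?_, fun f g => ?_, fun c => ?_⟩
    · simp only [Pi.add_apply, h₁, h₁']; ring
    · simp only [Pi.add_apply, h₂, h₂']; ring
    · simp only [Pi.add_apply, h₃, h₃', add_zero]
  zero_mem' := by simp
  smul_mem' := by
    rintro c D ⟨h₁, h₂, h₃⟩
    refine ⟨fun f g => ?_, fun f g => ?_, fun c => ?_⟩
    · simp only [Pi.smul_apply, h₁, smul_add]
    · simp only [Pi.smul_apply, h₂, smul_eq_mul]; ring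
    · simp only [Pi.smul_apply, h₃, smul_zero]

/-- The local homomorphism `𝒪_{X,a} → 𝒪_{Y,b}` induced by a morphism `f : Y ⟶ X` with
`f(b) = a`. -/
def localMap (f : Y ⟶ X) (b : CPoint Y) (a : CPoint X) (h : b.1 ≫ f = a.1) :
    a.localRing →+* b.localRing :=
  (f.stalkMap b.pt).hom.comp
    (X.presheaf.stalkSpecializes
      (specializes_of_eq (by rw [CPoint.pt, CPoint.pt, ← h]; rfl : f b.pt = a.pt))).hom

lemma localMap_germ (f : Y ⟶ X) (b : CPoint Y) (a : CPoint X) (h : b.1 ≫ f = a.1)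
    (g : Γ(X, ⊤)) : localMap f b a h (a.germ g) = b.germ (f.appTop g) := by
  have hab : f b.pt = a.pt := by rw [CPoint.pt, CPoint.pt, ← h]; rfl
  have e := TopCat.Presheaf.germ_stalkSpecializes_apply (F := X.presheaf) (U := ⊤) (y := a.pt)
    (TopologicalSpace.Opens.mem_top _) (specializes_of_eq hab) g
  exact (congrArg (f.stalkMap b.pt).hom e).trans
    (Scheme.Hom.germ_stalkMap_apply f ⊤ b.pt (TopologicalSpace.Opens.mem_top _) g)

lemma eval_localMap (f : Y ⟶ X) (b : CPoint Y) (a : CPoint X) (h : b.1 ≫ f = a.1)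
    (g : a.localRing) : b.eval (localMap f b a h g) = a.eval g := by
  have e := stalkClosedPointTo_congr h
    (specializes_of_eq (by rw [h]))
  rw [Scheme.stalkClosedPointTo_comp] at e
  exact congrArg (fun k => k.hom g) e

/-- The differential `(df)_b : T_b Y → T_a X` at `b` of a morphism `f : Y ⟶ X` of schemes over
`ℂ` with `f(b) = a`. -/
def differential (f : Y ⟶ X) (hf : f ≫ (X ↘ SpecC) = Y ↘ SpecC)
    (b : CPoint Y) (a : CPoint X) (h : b.1 ≫ f = a.1) :
    TangentSpace b →ₗ[ℂ] TangentSpace a where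
  toFun D := ⟨fun g => D.1 (localMap f b a h g), by
    obtain ⟨D, h₁, h₂, h₃⟩ := D
    refine ⟨fun f g => ?_, fun f g => ?_, fun c => ?_⟩
    · simp only [map_add, h₁]
    · simp only [map_mul, h₂, eval_localMap]
    · have : f.appTop (constants X c) = constants Y c := by
        simp only [constants, ← hf, Scheme.Hom.comp_appTop]
        rfl
      simp only [localMap_germ, this, h₃]⟩
  map_add' _ _ := rfl
  map_smul' _ _ := rfl

end Tangent

/-! ### Actions of the additive group and flexibility -/

section Actions

open AffineSpace

/-- For a morphism `m : X × 𝔸¹ ⟶ X`, a `T`-valued point `x` of `X` and a regular function `t` on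
`T`, this is the `T`-valued point `m(x, t)`. -/
def applyFlow {X : Scheme.{0}} (m : 𝔸(Unit; X) ⟶ X) {T : Scheme.{0}} (t : Γ(T, ⊤)) (x : T ⟶ X) :
    T ⟶ X :=
  homOfVector x (fun _ => t) ≫ m

/-- An algebraic action of the additive group `(ℂ, +)` on `X`, that is, a (parametrized)
one-parameter unipotent subgroup `t ↦ U_t` of `Aut X`. The group laws are stated on points with
values in arbitrary schemes. -/
structure GaAction (X : Scheme.{0}) [X.Over SpecC] where
  /-- The action morphism `(x, t) ↦ U_t x`. -/
  hom : 𝔸(Unit; X) ⟶ X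
  hom_over : hom ≫ (X ↘ SpecC) = (𝔸(Unit; X) ↘ X) ≫ (X ↘ SpecC)
  zero_act : ∀ {T : Scheme.{0}} (x : T ⟶ X), applyFlow hom 0 x = x
  add_act : ∀ {T : Scheme.{0}} (s t : Γ(T, ⊤)) (x : T ⟶ X),
    applyFlow hom (s + t) x = applyFlow hom s (applyFlow hom t x)

variable {X : Scheme.{0}} [X.Over SpecC]

/-- The parametrization `t ↦ U_t a` of the orbit of a complex point `a`, as a morphism
`𝔸¹ ⟶ X`. -/
def GaAction.orbit (φ : GaAction X) (a : CPoint X) : 𝔸(Unit; SpecC) ⟶ X :=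
  applyFlow φ.hom (coord SpecC ()) ((𝔸(Unit; SpecC) ↘ SpecC) ≫ a.1)

/-- The origin of the affine line over `ℂ`. -/
def lineOrigin : CPoint 𝔸(Unit; SpecC) :=
  ⟨homOfVector (𝟙 SpecC) (fun _ => 0), homOfVector_over _ _⟩

lemma GaAction.orbit_over (φ : GaAction X) (a : CPoint X) :
    φ.orbit a ≫ (X ↘ SpecC) = 𝔸(Unit; SpecC) ↘ SpecC := by
  simp only [GaAction.orbit, applyFlow, Category.assoc, φ.hom_over, homOfVector_over_assoc, a.2,
    Category.comp_id]

lemma GaAction.origin_orbit (φ : GaAction X) (a : CPoint X) :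
    lineOrigin.1 ≫ φ.orbit a = a.1 := by
  rw [← φ.zero_act a.1]
  simp only [lineOrigin, GaAction.orbit, applyFlow, ← Category.assoc, comp_homOfVector,
    homOfVector_over, Category.id_comp]
  congr 2
  funext i
  exact homOfVector_appTop_coord (𝟙 SpecC) (fun _ => 0) ()

/-- The tangent vectors at `a` to the orbit of `a` under a one-parameter unipotent subgroup. -/
def GaAction.orbitTangent (φ : GaAction X) (a : CPoint X) : Submodule ℂ (TangentSpace a) :=
  LinearMap.range
    (differential (φ.orbit a) (φ.orbit_over a) lineOrigin a (φ.origin_orbit a))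

/-- `X` is flexible: at every point the tangent space is spanned by the tangent vectors to the
orbits of the one-parameter unipotent subgroups of `Aut X`. -/
def IsFlexible (X : Scheme.{0}) [X.Over SpecC] : Prop :=
  ∀ a : CPoint X, ⨆ φ : GaAction X, φ.orbitTangent a = ⊤

/-! ### Locally nilpotent vector fields and their flows -/

/-- A derivation of the ring of regular functions is locally nilpotent if every function is killed
by some iterate of it. -/
def IsLocallyNilpotent (σ : Derivation ℂ Γ(X, ⊤) Γ(X, ⊤)) : Prop :=
  ∀ f : Γ(X, ⊤), ∃ n : ℕ, (σ^[n]) f = 0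

/-- The additive group action `φ` is the flow of the locally nilpotent vector field `σ`:
`f (U_t x) = ∑ₙ (tⁿ / n!) (σⁿ f) (x)` for all regular functions `f` on `X`. The sum is finite:
it may be cut off at any `N` with `σᴺ f = 0`. -/
def GaAction.IsFlowOf (φ : GaAction X) (σ : Derivation ℂ Γ(X, ⊤) Γ(X, ⊤)) : Prop :=
  IsLocallyNilpotent σ ∧ ∀ (f : Γ(X, ⊤)) (N : ℕ), (σ^[N]) f = 0 →
    φ.hom.appTop f = ∑ n ∈ Finset.range N,
      (coord X ()) ^ n * (𝔸(Unit; X) ↘ X).appTop (((n.factorial : ℂ)⁻¹) • (σ^[n]) f)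

/-- The tangent vector `v` is the value at `a` of the vector field `σ`. On a quasi-affine scheme
the local ring at `a` is a localization of the ring of global functions, so a tangent vector is
determined by what it does to global functions. -/
def IsValueAt (σ : Derivation ℂ Γ(X, ⊤) Γ(X, ⊤)) (a : CPoint X) (v : TangentSpace a) : Prop :=
  ∀ f : Γ(X, ⊤), v.1 (a.germ f) = a.eval (a.germ (σ f))

/-- The values of the vector fields `σ i` span the tangent space at every point. -/
def SpanTangentSpaces {l : ℕ} (σ : Fin l → Derivation ℂ Γ(X, ⊤) Γ(X, ⊤)) : Prop :=
  ∀ a : CPoint X, ∃ v : Fin l → TangentSpace a,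
    (∀ i, IsValueAt (σ i) a (v i)) ∧ Submodule.span ℂ (Set.range v) = ⊤

/-- The morphism `X × 𝔸ˡ ⟶ X`, `(x, t₁, …, t_l) ↦ U¹_{t₁} (U²_{t₂} (⋯ U^l_{t_l} (x)))`. -/
def compositeFlow {l : ℕ} (φ : Fin l → GaAction X) : 𝔸(Fin l; X) ⟶ X :=
  (List.finRange l).foldr (fun i x => applyFlow (φ i).hom (coord X i) x) (𝔸(Fin l; X) ↘ X)

end Actions

/-! ### Algebraic vector bundles -/

section Bundles

open AffineSpace Limits

/-- An algebraic vector bundle on `X`: a morphism `p : E ⟶ X` which over the members of a Zariski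
open cover is identified with a product with an affine space, such that on overlaps the
identifications differ by a matrix of regular functions acting linearly on the fibres. -/
structure AlgVectorBundle (X : Scheme.{0}) where
  /-- The total space. -/
  total : Scheme.{0}
  /-- The bundle projection. -/
  proj : total ⟶ X
  /-- A trivializing open cover. -/
  cover : Scheme.OpenCover.{0} X
  /-- The rank over each member of the cover. -/
  rank : cover.I₀ → ℕ
  /-- The trivializations, as maps `Uᵢ × 𝔸^{rᵢ} ⟶ E`. -/
  triv : ∀ i, 𝔸(Fin (rank i); cover.X i) ⟶ total
  /-- `triv i` identifies `Uᵢ × 𝔸^{rᵢ}` with the restriction of `E` to `Uᵢ`. -/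
  isPullback : ∀ i, IsPullback (triv i) (𝔸(Fin (rank i); cover.X i) ↘ cover.X i) proj (cover.f i)
  /-- Linear transition: the fibre coordinates `v` for `i` correspond to `g v` for `j`. -/
  transition : ∀ i j, ∃ g : Matrix (Fin (rank j)) (Fin (rank i))
      Γ(pullback (cover.f i) (cover.f j), ⊤),
    ∀ {T : Scheme.{0}} (u : T ⟶ pullback (cover.f i) (cover.f j)) (v : Fin (rank i) → Γ(T, ⊤)),
      homOfVector (u ≫ pullback.fst (cover.f i) (cover.f j)) v ≫ triv i =
        homOfVector (u ≫ pullback.snd (cover.f i) (cover.f j))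
          ((g.map u.appTop).mulVec v) ≫ triv j

/-- The zero section of an algebraic vector bundle, glued from the zero sections of the
trivializations. -/
def AlgVectorBundle.zero {X : Scheme.{0}} (E : AlgVectorBundle X) : X ⟶ E.total :=
  E.cover.glueMorphisms
    (fun i => homOfVector (𝟙 (E.cover.X i)) (fun _ => 0) ≫ E.triv i) (by
      intro i j
      obtain ⟨g, hg⟩ := E.transition i j
      have h := hg (𝟙 _) (fun _ => 0)
      rw [← Pi.zero_def, Matrix.mulVec_zero] at h
      simp only [← Category.assoc, comp_homOfVector]
      simpa [Function.comp_def, Pi.zero_def] using h)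

lemma AlgVectorBundle.cover_zero {X : Scheme.{0}} (E : AlgVectorBundle X) (i : E.cover.I₀) :
    E.cover.f i ≫ E.zero = homOfVector (𝟙 (E.cover.X i)) (fun _ => 0) ≫ E.triv i :=
  Scheme.Cover.ι_glueMorphisms _ _ _ i

lemma AlgVectorBundle.zero_proj {X : Scheme.{0}} (E : AlgVectorBundle X) :
    E.zero ≫ E.proj = 𝟙 X := by
  refine E.cover.hom_ext _ _ fun i => ?_
  rw [AlgVectorBundle.zero, Scheme.Cover.ι_glueMorphisms_assoc, Category.assoc, (E.isPullback i).w,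
    homOfVector_over_assoc, Category.id_comp, Category.comp_id]

/-- The trivial vector bundle of rank `l`, with total space `X × 𝔸ˡ`. -/
def trivialBundle (X : Scheme.{0}) (l : ℕ) : AlgVectorBundle X where
  total := 𝔸(Fin l; X)
  proj := 𝔸(Fin l; X) ↘ X
  cover := Scheme.coverOfIsIso (𝟙 X)
  rank _ := l
  triv _ := 𝟙 𝔸(Fin l; X)
  isPullback _ := IsPullback.id_horiz (𝔸(Fin l; X) ↘ X)
  transition i j := by
    refine ⟨1, fun {T} u v => ?_⟩
    have h := pullback.condition (f := 𝟙 X) (g := 𝟙 X)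
    simp only [Category.comp_id] at h
    have h1 : (1 : Matrix (Fin l) (Fin l) Γ(pullback (𝟙 X) (𝟙 X), ⊤)).map u.appTop = 1 :=
      Matrix.map_one _ (map_zero _) (map_one _)
    change homOfVector (u ≫ pullback.fst (𝟙 X) (𝟙 X)) v ≫ 𝟙 _ =
      homOfVector (u ≫ pullback.snd (𝟙 X) (𝟙 X)) (((1 : Matrix (Fin l) (Fin l)
        Γ(pullback (𝟙 X) (𝟙 X), ⊤)).map u.appTop).mulVec v) ≫ 𝟙 _
    rw [h1, Matrix.one_mulVec, h]

instance {X : Scheme.{0}} [X.Over SpecC] (E : AlgVectorBundle X) : E.total.Over SpecC :=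
  ⟨E.proj ≫ (X ↘ SpecC)⟩

/-! ### Sprays and ellipticity -/

variable {X : Scheme.{0}} [X.Over SpecC]

/-- The point `0_a` of the zero section over a complex point `a`. -/
def AlgVectorBundle.zeroAt (E : AlgVectorBundle X) (a : CPoint X) : CPoint E.total :=
  ⟨a.1 ≫ E.zero, by
    change (a.1 ≫ E.zero) ≫ E.proj ≫ (X ↘ SpecC) = 𝟙 _
    rw [Category.assoc, ← Category.assoc E.zero, E.zero_proj, Category.id_comp, a.2]⟩

/-- An algebraic spray on `X` with bundle `E`: a morphism `s : E ⟶ X` of schemes over `ℂ` which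
on the zero section agrees with the projection. -/
structure IsSpray (E : AlgVectorBundle X) (s : E.total ⟶ X) : Prop where
  over_base : s ≫ (X ↘ SpecC) = E.total ↘ SpecC
  zero_comp : E.zero ≫ s = 𝟙 X

lemma IsSpray.zeroAt_comp {E : AlgVectorBundle X} {s : E.total ⟶ X} (h : IsSpray E s)
    (a : CPoint X) : (E.zeroAt a).1 ≫ s = a.1 := by
  simp [AlgVectorBundle.zeroAt, h.zero_comp]

lemma AlgVectorBundle.zeroAt_proj (E : AlgVectorBundle X) (a : CPoint X) :
    (E.zeroAt a).1 ≫ E.proj = a.1 := by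
  simp [AlgVectorBundle.zeroAt, E.zero_proj]

/-- The vertical tangent space at the point `0_a` of the zero section: the tangent space of the
fibre of `E` over `a`, as the kernel of the differential of the projection. -/
def AlgVectorBundle.vertical (E : AlgVectorBundle X) (a : CPoint X) :
    Submodule ℂ (TangentSpace (E.zeroAt a)) :=
  LinearMap.ker (differential E.proj rfl (E.zeroAt a) a (E.zeroAt_proj a))

/-- A spray is dominating if at each point of the zero section its differential maps the tangent
space of the fibre onto the tangent space of `X`. -/
def IsDominatingSpray (E : AlgVectorBundle X) (s : E.total ⟶ X) : Prop :=
  ∃ h : IsSpray E s, ∀ a : CPoint X,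
    (E.vertical a).map (differential s h.over_base (E.zeroAt a) a (h.zeroAt_comp a)) = ⊤

/-- `X` is algebraically elliptic: it admits a dominating algebraic spray. -/
def IsAlgebraicallyElliptic (X : Scheme.{0}) [X.Over SpecC] : Prop :=
  ∃ (E : AlgVectorBundle X) (s : E.total ⟶ X), IsDominatingSpray E s

end Bundles

end AlgSpray

end

/-! An action of (ℂ,+) amounts to a coaction 𝒪(X) → 𝒪(X)[t], because functions on X × 𝔸¹ are
polynomials over 𝒪(X) (`polyEquiv`). Its coefficient of t is a derivation σ. Comparing the terms
linear in s in U_{s+t} = U_s ∘ U_t shows that the coaction turns σ into d/dt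
(`GaAction.coaction_field`). So σⁿ f is n! times the n-th coefficient; hence σ is locally nilpotent
and the action is its flow. Since X is quasi-affine, global functions separate tangent vectors, and
the orbit tangent at a is the span of σ(a) (`GaAction.orbitTangent_eq`).

Flexibility at a provides d = dim T_aX actions whose fields form a basis of T_aX. Choose global
functions h_j dual to these values. Then det(σ_i h_j) is nonzero at a, hence near a, and smoothness
keeps the dimension equal to d there, so the same fields span all nearby tangent spaces
(`exists_open_spanning`). Quasi-compactness leaves finitely many fields (`exists_finite_spanning`).

On the i-th axis of the fibre over a, the composite flow is just the orbit of a under U^i, since all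
other times vanish. Its vertical differential at 0_a therefore hits every σ_i(a), whatever the order
of composition (`orbitTangent_le_map_vertical`). -/

noncomputable section

namespace AlgSpray

/-! ### Regular functions on X × 𝔸¹ as polynomials. -/

section PolynomialFunctions

open AffineSpace Limits

/-- Polynomials over the ring of regular functions of `X`, as regular functions on `X × 𝔸¹`. -/
def polyMap (X : Scheme.{0}) : Polynomial Γ(X, ⊤) →+* Γ(𝔸(Unit; X), ⊤) :=
  Polynomial.eval₂RingHom (𝔸(Unit; X) ↘ X).appTop.hom (coord X ())

lemma polyMap_apply (X : Scheme.{0}) (p : Polynomial Γ(X, ⊤)) :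
    polyMap X p = p.eval₂ (𝔸(Unit; X) ↘ X).appTop.hom (coord X ()) := rfl

lemma homOfVector_appTop_polyMap {X T : Scheme.{0}} (x : T ⟶ X) (t : Γ(T, ⊤))
    (p : Polynomial Γ(X, ⊤)) :
    (homOfVector x (fun _ : Unit => t)).appTop (polyMap X p) = p.eval₂ x.appTop.hom t := by
  rw [polyMap_apply]
  refine (Polynomial.hom_eval₂ _ _ (homOfVector x (fun _ : Unit => t)).appTop.hom _).trans ?_
  congr 1
  · rw [← CommRingCat.hom_comp, ← Scheme.Hom.comp_appTop, homOfVector_over]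
  · exact homOfVector_appTop_coord x (fun _ : Unit => t) ()

lemma map_appTop_polyMap {X Y : Scheme.{0}} (f : Y ⟶ X) (p : Polynomial Γ(X, ⊤)) :
    (AffineSpace.map Unit f).appTop (polyMap X p) = polyMap Y (p.map f.appTop.hom) := by
  refine (homOfVector_appTop_polyMap _ (coord Y ()) p).trans ?_
  rw [polyMap_apply, Polynomial.eval₂_map, Scheme.Hom.comp_appTop]
  rfl

lemma polyMap_bijective_of_isAffine (X : Scheme.{0}) [IsAffine X] :
    Function.Bijective (polyMap X) := by
  have h1 := isoOfIsAffine_hom_appTop (n := Unit) (S := X)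
  have h2 : CommRingCat.ofHom
        (MvPolynomial.eval₂Hom ((𝔸(Unit; X) ↘ X).appTop).hom (coord X)) =
      (Scheme.ΓSpecIso _).inv ≫ (isoOfIsAffine Unit X).hom.appTop := by
    rw [h1, Iso.inv_hom_id_assoc]
  have h3 : IsIso (CommRingCat.ofHom
        (MvPolynomial.eval₂Hom ((𝔸(Unit; X) ↘ X).appTop).hom (coord X))) := by
    rw [h2]
    exact IsIso.comp_isIso' inferInstance (inferInstanceAs (IsIso (Scheme.Hom.app _ ⊤)))
  have h4 := (ConcreteCategory.isIso_iff_bijective _).mp h3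
  have h5 : (polyMap X : Polynomial Γ(X, ⊤) → Γ(𝔸(Unit; X), ⊤)) =
      (MvPolynomial.eval₂Hom ((𝔸(Unit; X) ↘ X).appTop).hom (coord X)) ∘
        (MvPolynomial.uniqueAlgEquiv Γ(X, ⊤) Unit).symm := by
    funext p
    exact (MvPolynomial.eval₂_uniqueAlgEquiv_symm (f := p)
      (φ := (𝔸(Unit; X) ↘ X).appTop.hom) (a := coord X)).symm
  rw [h5]
  exact Function.Bijective.comp h4 (AlgEquiv.bijective _)

/-- Coefficients can be tested on an affine cover, so no compactness is needed; this matters for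
overlaps of charts in `polyMap_surjective`. -/
lemma polyMap_injective (X : Scheme.{0}) : Function.Injective (polyMap X) := by
  rw [injective_iff_map_eq_zero]
  intro p hp
  ext k
  rw [Polynomial.coeff_zero]
  refine X.affineCover.ext_elem _ _ fun i => ?_
  rw [map_zero]
  have h : polyMap _ (p.map (X.affineCover.f i).appTop.hom) = 0 := by
    rw [← map_appTop_polyMap, hp, map_zero]
  rw [← map_zero (polyMap _)] at h
  have h' := congrArg (fun q => q.coeff k) ((polyMap_bijective_of_isAffine _).1 h)
  simp only [Polynomial.coeff_map, Polynomial.coeff_zero] at h'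
  exact h'

/-- Regular functions on the members of an open cover glue if they agree on overlaps. -/
lemma exists_glue {X : Scheme.{0}} (𝒰 : X.OpenCover) (s : ∀ i, Γ(𝒰.X i, ⊤))
    (hs : ∀ i j, (pullback.fst (𝒰.f i) (𝒰.f j)).appTop (s i) =
      (pullback.snd (𝒰.f i) (𝒰.f j)).appTop (s j)) :
    ∃ g : Γ(X, ⊤), ∀ i, (𝒰.f i).appTop g = s i := by
  -- A regular function is a morphism to Spec ℤ[t], and morphisms glue.
  let F : X ⟶ _ := 𝒰.glueMorphisms
    (fun i => (toSpecMvPolyIntEquiv Unit).symm (fun _ => s i)) (by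
      intro i j
      apply (toSpecMvPolyIntEquiv Unit).injective
      funext k
      rw [toSpecMvPolyIntEquiv_comp, toSpecMvPolyIntEquiv_comp, Equiv.apply_symm_apply,
        Equiv.apply_symm_apply]
      exact hs i j)
  refine ⟨toSpecMvPolyIntEquiv Unit F (), fun i => ?_⟩
  rw [← toSpecMvPolyIntEquiv_comp, Scheme.Cover.ι_glueMorphisms, Equiv.apply_symm_apply]

/-- Regular functions on `X × 𝔸¹` may be compared on an open cover of `X`. -/
lemma ext_of_cover {X : Scheme.{0}} (𝒰 : X.OpenCover) {F G : Γ(𝔸(Unit; X), ⊤)}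
    (h : ∀ i, (AffineSpace.map Unit (𝒰.f i)).appTop F =
      (AffineSpace.map Unit (𝒰.f i)).appTop G) : F = G := by
  refine Scheme.OpenCover.ext_elem _ _ (Precoverage.ZeroHypercover.pullback₁ (𝔸(Unit; X) ↘ X) 𝒰) fun i => ?_
  have e : pullback.fst (𝔸(Unit; X) ↘ X) (𝒰.f i) =
      (isPullback_map (n := Unit) (𝒰.f i)).isoPullback.inv ≫ AffineSpace.map Unit (𝒰.f i) :=
    (isPullback_map (n := Unit) (𝒰.f i)).isoPullback_inv_fst.symm
  change (pullback.fst (𝔸(Unit; X) ↘ X) (𝒰.f i)).appTop F =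
    (pullback.fst (𝔸(Unit; X) ↘ X) (𝒰.f i)).appTop G
  rw [e, Scheme.Hom.comp_appTop]
  exact congrArg (isPullback_map (n := Unit) (𝒰.f i)).isoPullback.inv.appTop (h i)

/-- On each affine chart the function is a polynomial; injectivity over the overlaps makes the
coefficients agree there, so they glue one by one. -/
lemma polyMap_surjective (X : Scheme.{0}) [CompactSpace X] : Function.Surjective (polyMap X) := by
  intro F
  let 𝒰 := X.affineCover.finiteSubcover
  have : ∀ i, IsAffine (𝒰.X i) := fun i => inferInstanceAs (IsAffine (X.affineCover.X _))
  have : Fintype 𝒰.I₀ := Fintype.ofFinite _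
  choose p hp using fun i =>
    (polyMap_bijective_of_isAffine (𝒰.X i)).2 ((AffineSpace.map Unit (𝒰.f i)).appTop F)
  have hov : ∀ i j, (p i).map (pullback.fst (𝒰.f i) (𝒰.f j)).appTop.hom =
      (p j).map (pullback.snd (𝒰.f i) (𝒰.f j)).appTop.hom := by
    intro i j
    apply polyMap_injective
    rw [← map_appTop_polyMap, ← map_appTop_polyMap, hp, hp, ← CommRingCat.comp_apply,
      ← CommRingCat.comp_apply, ← Scheme.Hom.comp_appTop, ← Scheme.Hom.comp_appTop,
      ← AffineSpace.map_comp, ← AffineSpace.map_comp, pullback.condition]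
  choose c hc using fun k => exists_glue 𝒰 (fun i => (p i).coeff k) (fun i j => by
    have := congrArg (fun q => q.coeff k) (hov i j)
    simpa only [Polynomial.coeff_map] using this)
  -- Finiteness of the cover bounds the degrees uniformly, so the glued coefficients form a
  -- polynomial.
  let N := Finset.univ.sup (fun i => (p i).natDegree) + 1
  refine ⟨∑ k ∈ Finset.range N, Polynomial.monomial k (c k), ext_of_cover 𝒰 fun i => ?_⟩
  rw [map_appTop_polyMap, ← hp]
  congr 1
  rw [Polynomial.map_sum, (p i).as_sum_range' N
    (Nat.lt_succ_of_le (Finset.le_sup (f := fun i => (p i).natDegree) (Finset.mem_univ i)))]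
  refine Finset.sum_congr rfl fun k _ => ?_
  rw [Polynomial.map_monomial]
  exact congrArg _ (hc k i)

/-- Over a quasi-compact scheme, the regular functions on `X × 𝔸¹` are the polynomials over the
ring of regular functions on `X`. -/
def polyEquiv (X : Scheme.{0}) [CompactSpace X] : Polynomial Γ(X, ⊤) ≃+* Γ(𝔸(Unit; X), ⊤) :=
  RingEquiv.ofBijective (polyMap X) ⟨polyMap_injective X, polyMap_surjective X⟩

end PolynomialFunctions

/-! ### The locally nilpotent vector field of an additive group action. -/

section Flows

open AffineSpace

variable {X : Scheme.{0}} [X.Over SpecC] [CompactSpace X]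

/-- The coaction `𝒪(X) → 𝒪(X)[t]` of an algebraic action of the additive group. -/
def GaAction.coaction (φ : GaAction X) : Γ(X, ⊤) →+* Polynomial Γ(X, ⊤) :=
  (polyEquiv X).symm.toRingHom.comp φ.hom.appTop.hom

lemma GaAction.polyMap_coaction (φ : GaAction X) (f : Γ(X, ⊤)) :
    polyMap X (φ.coaction f) = φ.hom.appTop f :=
  (polyEquiv X).apply_symm_apply _

lemma GaAction.applyFlow_appTop (φ : GaAction X) {T : Scheme.{0}} (t : Γ(T, ⊤)) (x : T ⟶ X)
    (f : Γ(X, ⊤)) :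
    (applyFlow φ.hom t x).appTop f = (φ.coaction f).eval₂ x.appTop.hom t := by
  rw [applyFlow, Scheme.Hom.comp_appTop, CommRingCat.comp_apply, ← φ.polyMap_coaction,
    homOfVector_appTop_polyMap]

lemma GaAction.coeff_zero_coaction (φ : GaAction X) (f : Γ(X, ⊤)) :
    (φ.coaction f).coeff 0 = f := by
  have h := φ.applyFlow_appTop 0 (𝟙 X) f
  rw [φ.zero_act, Polynomial.eval₂_at_zero] at h
  exact h.symm

lemma GaAction.coaction_constants (φ : GaAction X) (c : ℂ) :
    φ.coaction (constants X c) = Polynomial.C (constants X c) := by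
  apply polyMap_injective
  rw [φ.polyMap_coaction, polyMap_apply, Polynomial.eval₂_C]
  have h := congrArg (fun g => g.appTop ((Scheme.ΓSpecIso (CommRingCat.of ℂ)).inv c)) φ.hom_over
  simp only [Scheme.Hom.comp_appTop, CommRingCat.comp_apply] at h
  exact h

/-- The vector field generating an algebraic action of the additive group. -/
def GaAction.field (φ : GaAction X) : Derivation ℂ Γ(X, ⊤) Γ(X, ⊤) where
  toFun f := (φ.coaction f).coeff 1
  map_add' f g := by rw [map_add, Polynomial.coeff_add]
  map_smul' c f := by
    rw [Algebra.smul_def, map_mul]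
    change (φ.coaction (constants X c) * _).coeff 1 = c • _
    rw [φ.coaction_constants, Polynomial.coeff_C_mul, Algebra.smul_def]
    rfl
  map_one_eq_zero' := by
    change (φ.coaction 1).coeff 1 = 0
    rw [map_one, Polynomial.coeff_one]
    simp
  leibniz' f g := by
    change (φ.coaction (f * g)).coeff 1 = f • (φ.coaction g).coeff 1 + g • (φ.coaction f).coeff 1
    rw [map_mul, Polynomial.mul_coeff_one, φ.coeff_zero_coaction, φ.coeff_zero_coaction,
      smul_eq_mul, smul_eq_mul]
    ring

/-- The infinitesimal form of the group law. -/
lemma GaAction.coaction_field (φ : GaAction X) (f : Γ(X, ⊤)) :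
    φ.coaction (φ.field f) = (φ.coaction f).derivative := by
  let Y := 𝔸(Unit; X)
  let T := 𝔸(Unit; Y)
  let t : Γ(Y, ⊤) := coord X ()
  let π := 𝔸(Unit; X) ↘ X
  let q := 𝔸(Unit; Y) ↘ Y
  -- The identity f(U_{s+t} x) = f(U_s(U_t x)) for the universal triple: t and x live on `Y`, and s
  -- is the coordinate of `T` over `Y`.
  have hadd := congrArg (fun g => g.appTop f) (φ.add_act (coord Y ()) (q.appTop t) (q ≫ π))
  dsimp only at hadd
  have hflow : applyFlow φ.hom (q.appTop t) (q ≫ π) = q ≫ φ.hom := by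
    rw [applyFlow]
    congr 1
    refine AffineSpace.hom_ext (homOfVector_over _ _) fun i => ?_
    exact homOfVector_appTop_coord (q ≫ π) (fun _ : Unit => q.appTop t) i
  rw [hflow, φ.applyFlow_appTop, φ.applyFlow_appTop] at hadd
  have hl : (φ.coaction f).eval₂ (q ≫ π).appTop.hom (coord Y () + q.appTop t) =
      polyMap Y (Polynomial.taylor t ((φ.coaction f).map π.appTop.hom)) := by
    rw [polyMap_apply, Polynomial.taylor_apply, Polynomial.eval₂_comp, Polynomial.eval₂_add,
      Polynomial.eval₂_X, Polynomial.eval₂_C, Polynomial.eval₂_map, Scheme.Hom.comp_appTop]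
    rfl
  have hr : (φ.coaction f).eval₂ (q ≫ φ.hom).appTop.hom (coord Y ()) =
      polyMap Y ((φ.coaction f).map φ.hom.appTop.hom) := by
    rw [polyMap_apply, Polynomial.eval₂_map, Scheme.Hom.comp_appTop]
    rfl
  rw [hl, hr] at hadd
  -- The coefficient of s is the derivative of the coaction at t on the left, and the field applied
  -- to f, pulled back along U_t, on the right.
  have h := congrArg (fun p => p.coeff 1) (polyMap_injective Y hadd)
  simp only [Polynomial.taylor_coeff_one, Polynomial.coeff_map, Polynomial.derivative_map,
    Polynomial.eval_map] at h
  apply polyMap_injective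
  rw [φ.polyMap_coaction]
  exact h.symm

lemma GaAction.coaction_iterate_field (φ : GaAction X) (n : ℕ) (f : Γ(X, ⊤)) :
    φ.coaction (φ.field^[n] f) = Polynomial.derivative^[n] (φ.coaction f) := by
  induction n generalizing f with
  | zero => rfl
  | succ n ih => rw [Function.iterate_succ_apply, Function.iterate_succ_apply, ih, φ.coaction_field]

lemma GaAction.iterate_field (φ : GaAction X) (n : ℕ) (f : Γ(X, ⊤)) :
    φ.field^[n] f = n.factorial • (φ.coaction f).coeff n := by
  rw [← φ.coeff_zero_coaction (φ.field^[n] f), φ.coaction_iterate_field,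
    Polynomial.coeff_iterate_derivative, zero_add, Nat.descFactorial_self]

lemma GaAction.isLocallyNilpotent_field (φ : GaAction X) : IsLocallyNilpotent φ.field := by
  intro f
  refine ⟨(φ.coaction f).natDegree + 1, ?_⟩
  rw [φ.iterate_field, Polynomial.coeff_eq_zero_of_natDegree_lt (Nat.lt_succ_self _), smul_zero]

lemma GaAction.isFlowOf_field (φ : GaAction X) : φ.IsFlowOf φ.field := by
  refine ⟨φ.isLocallyNilpotent_field, fun f N hN => ?_⟩
  have hc : ∀ n, ((n.factorial : ℂ)⁻¹) • (φ.field^[n]) f = (φ.coaction f).coeff n := by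
    intro n
    rw [φ.iterate_field, ← Nat.cast_smul_eq_nsmul ℂ, inv_smul_smul₀]
    exact_mod_cast n.factorial_ne_zero
  -- The cut-off N is arbitrary, possibly below or above the degree bound; every coefficient from N
  -- on vanishes because σᴺ f = 0.
  have hz : ∀ n, N ≤ n → (φ.coaction f).coeff n = 0 := by
    intro n hn
    obtain ⟨k, rfl⟩ := Nat.exists_eq_add_of_le' hn
    rw [← hc, Function.iterate_add_apply, hN]
    rw [Function.iterate_fixed (map_zero φ.field), smul_zero]
  simp only [hc]
  rw [← φ.polyMap_coaction, polyMap_apply, Polynomial.eval₂_eq_sum_range'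
    (n := N + ((φ.coaction f).natDegree + 1)) _ (by omega)]
  symm
  refine (Finset.sum_congr rfl fun n _ => mul_comm _ _).trans
    (Finset.sum_subset (Finset.range_mono (Nat.le_add_right _ _)) fun n _ hn => ?_)
  rw [hz n (by simpa using hn), map_zero, zero_mul]

end Flows

/-! ### Tangent vectors as homomorphisms to the dual numbers. -/

section TangentVectors

open AffineSpace

variable {X : Scheme.{0}} [X.Over SpecC]

/-- The germ at `a` of a regular function on an open neighbourhood of `a`. -/
def CPoint.germOn (a : CPoint X) (U : X.Opens) (ha : a.pt ∈ U) : Γ(X, U) →+* a.localRing :=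
  (X.presheaf.germ U a.pt ha).hom

lemma CPoint.germOn_restrict (a : CPoint X) {U V : X.Opens} (ha : a.pt ∈ U) (i : U ⟶ V)
    (f : Γ(X, V)) : a.germOn U ha (X.presheaf.map i.op f) = a.germOn V (i.le ha) f :=
  X.presheaf.germ_res_apply i a.pt ha f

lemma CPoint.eval_germ (a : CPoint X) (f : Γ(X, ⊤)) :
    a.eval (a.germ f) = (Scheme.ΓSpecIso (CommRingCat.of ℂ)).hom (a.1.appTop f) := by
  have h := congrArg (fun k => k.hom f) (Scheme.germ_stalkClosedPointTo a.1 ⊤ trivial)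
  refine h.trans ?_
  simp only [CommRingCat.hom_comp, RingHom.comp_apply, Iso.trans_hom, Functor.mapIso_hom]
  rfl

lemma CPoint.eval_germ_constants (a : CPoint X) (c : ℂ) : a.eval (a.germ (constants X c)) = c := by
  rw [a.eval_germ]
  have h := congrArg (fun g => g.appTop ((Scheme.ΓSpecIso (CommRingCat.of ℂ)).inv c)) a.2
  simp only [Scheme.Hom.comp_appTop, CommRingCat.comp_apply] at h
  refine (congrArg (Scheme.ΓSpecIso (CommRingCat.of ℂ)).hom h).trans ?_
  simp

/-- A tangent vector at `a`, as a homomorphism from the local ring to the dual numbers. -/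
def dualHom {a : CPoint X} (D : TangentSpace a) : a.localRing →+* DualNumber ℂ where
  toFun g := (a.eval g, D.1 g)
  map_one' := by
    have h := D.2.2.2 1
    rw [map_one, map_one] at h
    rw [h, map_one]
    rfl
  map_mul' f g := by
    rw [D.2.2.1, map_mul]
    refine TrivSqZeroExt.ext rfl ?_
    change a.eval f * D.1 g + a.eval g * D.1 f = a.eval f * D.1 g + D.1 f * a.eval g
    ring
  map_zero' := by
    have h := D.2.2.2 0
    rw [map_zero, map_zero] at h
    rw [h, map_zero]
    rfl
  map_add' f g := by
    rw [D.2.1, map_add]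
    rfl

lemma snd_dualHom {a : CPoint X} (D : TangentSpace a) (g : a.localRing) :
    (dualHom D g).snd = D.1 g := rfl

lemma isUnit_of_isUnit_eval (a : CPoint X) {g : a.localRing} (h : IsUnit (a.eval g)) : IsUnit g :=
  (Scheme.isLocalHom_stalkClosedPointTo a.1).map_nonunit g h

lemma eq_of_dualHom_eq {a : CPoint X} {D D' : TangentSpace a} (h : dualHom D = dualHom D') :
    D = D' := by
  refine Subtype.ext (funext fun g => ?_)
  rw [← snd_dualHom, ← snd_dualHom, h]

lemma ringHom_ext_of_isAffineOpen (a : CPoint X) {U : X.Opens} (hU : IsAffineOpen U)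
    (ha : a.pt ∈ U) {R : Type*} [CommRing R] {F G : a.localRing →+* R}
    (h : F.comp (a.germOn U ha) = G.comp (a.germOn U ha)) : F = G := by
  algebraize [a.germOn U ha]
  have : IsLocalization.AtPrime a.localRing (hU.primeIdealOf ⟨a.pt, ha⟩).asIdeal :=
    hU.isLocalization_stalk ⟨a.pt, ha⟩
  exact IsLocalization.ringHom_ext (hU.primeIdealOf ⟨a.pt, ha⟩).asIdeal.primeCompl h

/-- Passing to ring homomorphisms into the dual numbers lets the universal property of localization
replace the quotient rule. -/
lemma TangentSpace.ext_of_isAffineOpen {a : CPoint X} {U : X.Opens} (hU : IsAffineOpen U)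
    (ha : a.pt ∈ U) {D D' : TangentSpace a}
    (h : ∀ f, D.1 (a.germOn U ha f) = D'.1 (a.germOn U ha f)) : D = D' :=
  eq_of_dualHom_eq (ringHom_ext_of_isAffineOpen a hU ha
    (RingHom.ext fun f => TrivSqZeroExt.ext rfl (h f)))

/-- On a quasi-affine scheme a tangent vector is determined by its values on global functions. -/
lemma TangentSpace.ext_of_isQuasiAffine [X.IsQuasiAffine] {a : CPoint X} {D D' : TangentSpace a}
    (h : ∀ f, D.1 (a.germ f) = D'.1 (a.germ f)) : D = D' := by
  -- Affine basic opens of global functions form a basis, and functions on such a set are the global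
  -- functions localized at r. Two localizations thus lead from Γ(X, ⊤) to the local ring.
  obtain ⟨_, ⟨_, ⟨r, hr, rfl⟩, rfl⟩, hxr, -⟩ :=
    (Scheme.IsQuasiAffine.isBasis_basicOpen X).exists_subset_of_mem_open
      (Set.mem_univ a.pt) isOpen_univ
  have := isLocalization_basicOpen_of_qcqs (X := X) isCompact_univ isQuasiSeparated_univ r
  refine eq_of_dualHom_eq (ringHom_ext_of_isAffineOpen a hr hxr ?_)
  refine IsLocalization.ringHom_ext (Submonoid.powers r) (RingHom.ext fun f => ?_)
  have e : a.germOn (X.basicOpen r) hxr (algebraMap Γ(X, ⊤) Γ(X, X.basicOpen r) f) = a.germ f :=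
    a.germOn_restrict hxr (homOfLE le_top) f
  change dualHom D (a.germOn _ hxr (algebraMap _ _ f)) =
    dualHom D' (a.germOn _ hxr (algebraMap _ _ f))
  rw [e]
  exact TrivSqZeroExt.ext rfl (h f)

/-- A homomorphism from the ring of functions on an affine neighbourhood of `a` to the dual
numbers which lifts the evaluation at `a` defines a tangent vector at `a`. -/
lemma TangentSpace.exists_of_isAffineOpen {a : CPoint X} {U : X.Opens} (hU : IsAffineOpen U)
    (ha : a.pt ∈ U) (Ψ : Γ(X, U) →+* DualNumber ℂ)
    (hΨ : ∀ f, (Ψ f).fst = a.eval (a.germOn U ha f))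
    (hc : ∀ c, (Ψ (X.presheaf.map (homOfLE le_top : U ⟶ ⊤).op (constants X c))).snd = 0) :
    ∃ D : TangentSpace a, ∀ f, D.1 (a.germOn U ha f) = (Ψ f).snd := by
  algebraize [a.germOn U ha]
  have : IsLocalization.AtPrime a.localRing (hU.primeIdealOf ⟨a.pt, ha⟩).asIdeal :=
    hU.isLocalization_stalk ⟨a.pt, ha⟩
  let M := (hU.primeIdealOf ⟨a.pt, ha⟩).asIdeal.primeCompl
  -- A dual number is a unit as soon as its real part is, so `Ψ` extends to the local ring.
  have hu : ∀ y : M, IsUnit (Ψ y) := by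
    intro y
    rw [TrivSqZeroExt.isUnit_iff_isUnit_fst, hΨ]
    exact (IsLocalization.map_units (M := M) a.localRing y).map a.eval
  let Ψ' : a.localRing →+* DualNumber ℂ := IsLocalization.lift (M := M) hu
  have h1 : ∀ f, Ψ' (a.germOn U ha f) = Ψ f := fun f => IsLocalization.lift_eq hu f
  have h2 : (TrivSqZeroExt.fstHom ℂ ℂ ℂ).toRingHom.comp Ψ' = a.eval := by
    refine ringHom_ext_of_isAffineOpen a hU ha (RingHom.ext fun f => ?_)
    change (Ψ' (a.germOn U ha f)).fst = _
    rw [h1, hΨ]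
    rfl
  have h3 : ∀ g, (Ψ' g).fst = a.eval g := fun g => congrArg (fun F => F g) h2
  refine ⟨⟨fun g => (Ψ' g).snd, fun f g => ?_, fun f g => ?_, fun c => ?_⟩, fun f => ?_⟩
  · dsimp only
    rw [map_add, TrivSqZeroExt.snd_add]
  · dsimp only
    rw [map_mul, DualNumber.snd_mul, h3, h3]
    ring
  · have e := a.germOn_restrict ha (homOfLE le_top : U ⟶ ⊤) (constants X c)
    change (Ψ' (a.germOn ⊤ _ (constants X c))).snd = 0
    rw [← e, h1, hc]
  · exact congrArg (TrivSqZeroExt.snd) (h1 f)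

end TangentVectors

/-! ### The affine line at its origin and the velocities of orbits. -/

section Orbits

open AffineSpace

variable {X : Scheme.{0}} [X.Over SpecC]

lemma lineOrigin_eval_polyMap (q : Polynomial Γ(SpecC, ⊤)) :
    lineOrigin.eval (lineOrigin.germ (polyMap SpecC q)) =
      (Scheme.ΓSpecIso (CommRingCat.of ℂ)).hom (q.coeff 0) := by
  rw [lineOrigin.eval_germ]
  congr 1
  refine (homOfVector_appTop_polyMap (𝟙 SpecC) 0 q).trans ?_
  rw [Polynomial.eval₂_at_zero]
  rfl

lemma constants_line (c : ℂ) : constants 𝔸(Unit; SpecC) c =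
    polyMap SpecC (Polynomial.C ((Scheme.ΓSpecIso (CommRingCat.of ℂ)).inv c)) := by
  rw [polyMap_apply, Polynomial.eval₂_C]
  rfl

/-- Write q = q₁·t + q(0) and apply the Leibniz rule at t = 0. Hence a tangent vector at the origin
is determined on polynomials by its value on t. -/
lemma tangent_polyMap (D : TangentSpace lineOrigin) (q : Polynomial Γ(SpecC, ⊤)) :
    D.1 (lineOrigin.germ (polyMap SpecC q)) =
      D.1 (lineOrigin.germ (coord SpecC ())) *
        (Scheme.ΓSpecIso (CommRingCat.of ℂ)).hom (q.coeff 1) := by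
  have hX : polyMap SpecC Polynomial.X = coord SpecC () := by
    rw [polyMap_apply, Polynomial.eval₂_X]
  have hC : D.1 (lineOrigin.germ (polyMap SpecC (Polynomial.C (q.coeff 0)))) = 0 := by
    have h := D.2.2.2 ((Scheme.ΓSpecIso (CommRingCat.of ℂ)).hom (q.coeff 0))
    rw [constants_line] at h
    simpa using h
  conv_lhs => rw [← Polynomial.divX_mul_X_add q]
  rw [map_add, map_add, D.2.1, hC, add_zero, map_mul, map_mul, D.2.2.1, lineOrigin_eval_polyMap,
    lineOrigin_eval_polyMap, Polynomial.coeff_X_zero, Polynomial.coeff_divX, hX]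
  rw [map_zero, zero_mul, add_zero, mul_comm]

/-- The tangent vector `∂/∂t` at the origin of the affine line. -/
lemma exists_lineTangent :
    ∃ D : TangentSpace lineOrigin, D.1 (lineOrigin.germ (coord SpecC ())) = 1 := by
  let ι : Γ(SpecC, ⊤) →+* DualNumber ℂ := (TrivSqZeroExt.inlHom ℂ ℂ).comp
    (Scheme.ΓSpecIso (CommRingCat.of ℂ)).hom.hom
  -- Evaluation at t = ε, whose ε-part is the derivative at 0.
  let Ψ : Γ(𝔸(Unit; SpecC), ⊤) →+* DualNumber ℂ :=
    (Polynomial.eval₂RingHom ι DualNumber.eps).comp (polyEquiv SpecC).symm.toRingHom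
  have hΨ : ∀ q, Ψ (polyMap SpecC q) = q.eval₂ ι DualNumber.eps := fun q =>
    congrArg (Polynomial.eval₂ ι DualNumber.eps) ((polyEquiv SpecC).symm_apply_apply q)
  obtain ⟨D, hD⟩ := TangentSpace.exists_of_isAffineOpen (a := lineOrigin)
    (isAffineOpen_top 𝔸(Unit; SpecC)) trivial Ψ (by
      intro F
      obtain ⟨q, rfl⟩ := polyMap_surjective SpecC F
      rw [hΨ]
      refine Eq.trans ?_ (lineOrigin_eval_polyMap q).symm
      refine (Polynomial.hom_eval₂ q ι (TrivSqZeroExt.fstHom ℂ ℂ ℂ).toRingHom _).trans ?_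
      change q.eval₂ _ (0 : ℂ) = _
      rw [Polynomial.eval₂_at_zero]
      rfl) (by
      intro c
      have : 𝔸(Unit; SpecC).presheaf.map (homOfLE le_top : (⊤ : 𝔸(Unit; SpecC).Opens) ⟶ ⊤).op
          (constants _ c) = constants _ c := by
        rw [Subsingleton.elim (homOfLE le_top : (⊤ : 𝔸(Unit; SpecC).Opens) ⟶ ⊤) (𝟙 _), op_id,
          CategoryTheory.Functor.map_id]
        rfl
      rw [this, constants_line, hΨ, Polynomial.eval₂_C]
      rfl)
  refine ⟨D, ?_⟩
  have h := hD (polyMap SpecC Polynomial.X)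
  rw [hΨ, Polynomial.eval₂_X, polyMap_apply, Polynomial.eval₂_X] at h
  exact h

/-- The tangent vector `∂/∂t` at the origin of the affine line. -/
def lineTangent : TangentSpace lineOrigin := exists_lineTangent.choose

lemma lineTangent_coord : lineTangent.1 (lineOrigin.germ (coord SpecC ())) = 1 :=
  exists_lineTangent.choose_spec

/-- The velocity at `a` of the orbit of `a`. -/
def GaAction.velocity (φ : GaAction X) (a : CPoint X) : TangentSpace a :=
  differential (φ.orbit a) (φ.orbit_over a) lineOrigin a (φ.origin_orbit a) lineTangent

lemma GaAction.differential_orbit [CompactSpace X] (φ : GaAction X) (a : CPoint X)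
    (D : TangentSpace lineOrigin) (f : Γ(X, ⊤)) :
    (differential (φ.orbit a) (φ.orbit_over a) lineOrigin a (φ.origin_orbit a) D).1 (a.germ f) =
      D.1 (lineOrigin.germ (coord SpecC ())) * a.eval (a.germ (φ.field f)) := by
  have h : (φ.orbit a).appTop f = polyMap SpecC ((φ.coaction f).map a.1.appTop.hom) := by
    rw [GaAction.orbit, φ.applyFlow_appTop, polyMap_apply, Polynomial.eval₂_map,
      Scheme.Hom.comp_appTop]
    rfl
  change D.1 (localMap _ _ _ _ (a.germ f)) = _
  rw [localMap_germ, h, tangent_polyMap, Polynomial.coeff_map, a.eval_germ]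
  rfl

lemma GaAction.isValueAt_velocity [CompactSpace X] (φ : GaAction X) (a : CPoint X) :
    IsValueAt φ.field a (φ.velocity a) := fun f => by
  rw [GaAction.velocity, φ.differential_orbit, lineTangent_coord, one_mul]

lemma GaAction.orbitTangent_eq [X.IsQuasiAffine] (φ : GaAction X) (a : CPoint X) :
    φ.orbitTangent a = Submodule.span ℂ {φ.velocity a} := by
  refine le_antisymm ?_ ?_
  · rintro _ ⟨D, rfl⟩
    refine Submodule.mem_span_singleton.2 ⟨D.1 (lineOrigin.germ (coord SpecC ())), ?_⟩
    refine TangentSpace.ext_of_isQuasiAffine fun f => ?_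
    rw [φ.differential_orbit, ← φ.isValueAt_velocity]
    rfl
  · rw [Submodule.span_singleton_le_iff_mem]
    exact ⟨_, rfl⟩

end Orbits

/-! ### Local constancy of the tangent dimension on a smooth scheme. -/

section Dimension

/-- Derivations into `ℂ` over a point `e`, in terms of a basis of the Kähler differentials. -/
lemma exists_linearEquiv_of_basis {B : Type} [CommRing B] [Algebra ℂ B] [Algebra B ℂ]
    [IsScalarTower ℂ B ℂ] {ι : Type} (b : Module.Basis ι B (KaehlerDifferential ℂ B)) :
    Nonempty (Derivation ℂ B ℂ ≃ₗ[ℂ] (ι → ℂ)) :=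
  ⟨((KaehlerDifferential.linearMapEquivDerivation ℂ B (M := ℂ)).restrictScalars ℂ).symm.trans
    (b.constr ℂ).symm⟩

variable {X : Scheme.{0}} [X.Over SpecC]

/-- The constant functions on an open subset. -/
def constantsOn (U : X.Opens) : ℂ →+* Γ(X, U) :=
  (X.presheaf.map (homOfLE le_top : U ⟶ ⊤).op).hom.comp (constants X)

/-- Tangent vectors at a are the derivations Γ(X, U) → ℂ over evaluation at a, that is, the linear
maps from the Kähler differentials to ℂ. One basis on U serves all points of U, so the dimension is
constant there. -/
lemma exists_tangentSpace_linearEquiv {U : X.Opens} (hU : IsAffineOpen U) {ι : Type}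
    (b : letI := (constantsOn U).toAlgebra
      Module.Basis ι Γ(X, U) (KaehlerDifferential ℂ Γ(X, U)))
    (a : CPoint X) (ha : a.pt ∈ U) : Nonempty (TangentSpace a ≃ₗ[ℂ] (ι → ℂ)) := by
  let := (constantsOn U).toAlgebra
  let := (a.eval.comp (a.germOn U ha)).toAlgebra
  have hcon : ∀ c, a.germOn U ha (constantsOn U c) = a.germ (constants X c) := fun c =>
    a.germOn_restrict ha (homOfLE le_top : U ⟶ ⊤) (constants X c)
  have : IsScalarTower ℂ Γ(X, U) ℂ := IsScalarTower.of_algebraMap_eq fun c => by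
    change c = a.eval (a.germOn U ha (constantsOn U c))
    rw [hcon, a.eval_germ_constants]
  obtain ⟨e⟩ := exists_linearEquiv_of_basis b
  have hsm : ∀ (f : Γ(X, U)) (z : ℂ), f • z = a.eval (a.germOn U ha f) * z := fun f z =>
    Algebra.smul_def f z
  let L : TangentSpace a →ₗ[ℂ] Derivation ℂ Γ(X, U) ℂ :=
    { toFun := fun D => Derivation.mk'
        { toFun := fun f => D.1 (a.germOn U ha f)
          map_add' := fun f g => by rw [map_add, D.2.1]
          map_smul' := fun c f => by
            rw [Algebra.smul_def, map_mul, D.2.2.1]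
            change a.eval (a.germOn U ha (constantsOn U c)) * _ +
              _ * D.1 (a.germOn U ha (constantsOn U c)) = c * _
            rw [hcon, D.2.2.2, a.eval_germ_constants, mul_zero, add_zero] }
        (fun f g => by
          change D.1 (a.germOn U ha (f * g)) = _
          rw [map_mul, D.2.2.1, hsm, hsm]
          rfl)
      map_add' := fun D D' => rfl
      map_smul' := fun c D => rfl }
  have hL : ∀ D f, L D f = D.1 (a.germOn U ha f) := fun D f => rfl
  refine ⟨(LinearEquiv.ofBijective L ⟨fun D D' h => ?_, fun d => ?_⟩).trans e⟩
  · exact TangentSpace.ext_of_isAffineOpen hU ha fun f => by rw [← hL, ← hL, h]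
  · let Ψ : Γ(X, U) →+* DualNumber ℂ :=
      { toFun := fun f => (a.eval (a.germOn U ha f), d f)
        map_one' := by rw [map_one, map_one, d.map_one_eq_zero]; rfl
        map_mul' := fun f g => by
          rw [map_mul, map_mul, d.leibniz, hsm, hsm]
          refine TrivSqZeroExt.ext rfl ?_
          change _ * d g + _ * d f = a.eval (a.germOn U ha f) * d g +
            d f * a.eval (a.germOn U ha g)
          ring
        map_zero' := by rw [map_zero, map_zero, map_zero]; rfl
        map_add' := fun f g => by rw [map_add, map_add, map_add]; rfl }
    obtain ⟨D, hD⟩ := TangentSpace.exists_of_isAffineOpen hU ha Ψ (fun _ => rfl)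
      (fun c => d.map_algebraMap c)
    exact ⟨D, Derivation.ext fun f => hD f⟩

/-- On a smooth scheme every point has an affine neighbourhood over which the Kähler differentials
are free of finite rank. -/
lemma exists_basis_kaehler [Smooth (X ↘ SpecC)] (x : X) :
    ∃ (U : X.Opens) (_ : IsAffineOpen U) (_ : x ∈ U) (d : ℕ),
      letI := (constantsOn U).toAlgebra
      Nonempty (Module.Basis (Fin d) Γ(X, U) (KaehlerDifferential ℂ Γ(X, U))) := by
  obtain ⟨V, hV, U, hU, hx, e, hs⟩ := Smooth.exists_isStandardSmooth (X ↘ SpecC) x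
  refine ⟨U, hU, hx, ?_⟩
  -- Spec ℂ has a single point.
  have hVtop : V = ⊤ := by
    refine eq_top_iff.2 fun y _ => ?_
    rw [Subsingleton.elim y ((X ↘ SpecC) x)]
    exact e hx
  subst hVtop
  have hc : constantsOn U = ((X ↘ SpecC).appLE ⊤ U e).hom.comp
      (Scheme.ΓSpecIso (CommRingCat.of ℂ)).symm.commRingCatIsoToRingEquiv.toRingHom := by
    rfl
  have hs' : (constantsOn U).IsStandardSmooth := by
    rw [hc]
    exact RingHom.isStandardSmooth_respectsIso.2 _ _ hs
  let := (constantsOn U).toAlgebra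
  have : Algebra.IsStandardSmooth ℂ Γ(X, U) := hs'
  have : Module.Free Γ(X, U) (KaehlerDifferential ℂ Γ(X, U)) := inferInstance
  have : Nontrivial Γ(X, U) := (X.presheaf.germ U x hx).hom.domain_nontrivial
  exact ⟨_, ⟨Module.finBasis _ _⟩⟩

end Dimension

/-! ### Finitely many fields spanning every tangent space. -/

section Spanning

/-- Linearly independent functionals take independent values: there are vectors dual to them. -/
lemma exists_dual_vectors {K V : Type*} [Field K] [AddCommGroup V] [Module K V] {d : ℕ}
    {w : Fin d → V →ₗ[K] K} (hw : LinearIndependent K w) :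
    ∃ h : Fin d → V, ∀ i j, w i (h j) = if i = j then 1 else 0 := by
  have hs : Function.Surjective (LinearMap.pi w) := by
    rw [← LinearMap.range_eq_top]
    by_contra hne
    -- A nonzero functional killing the range would be a linear relation among the `w i`.
    obtain ⟨F, hF0, hF⟩ := Submodule.exists_le_ker_of_lt_top _ (lt_top_iff_ne_top.2 hne)
    apply hF0
    have hsum : ∑ i, F (Pi.single i 1) • w i = 0 := by
      refine LinearMap.ext fun x => ?_
      have hx : F (LinearMap.pi w x) = 0 := hF ⟨x, rfl⟩
      rw [LinearMap.pi_apply_eq_sum_univ] at hx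
      rw [LinearMap.sum_apply, LinearMap.zero_apply, ← hx]
      refine Finset.sum_congr rfl fun i _ => ?_
      rw [LinearMap.smul_apply, smul_eq_mul, smul_eq_mul, mul_comm]
      congr 2
      funext j
      rw [Pi.single_apply]
      simp only [eq_comm]
    have hc := Fintype.linearIndependent_iff.1 hw _ hsum
    exact LinearMap.pi_ext' fun i => LinearMap.ext_ring (hc i)
  choose h hh using fun j => hs (Pi.single j 1)
  refine ⟨h, fun i j => ?_⟩
  have := congrFun (hh j) i
  rw [LinearMap.pi_apply, Pi.single_apply] at this
  exact this

variable {X : Scheme.{0}} [X.Over SpecC]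

lemma iSup_orbitTangent_eq [X.IsQuasiAffine] {ι : Type*} (φ : ι → GaAction X) (a : CPoint X) :
    ⨆ i, (φ i).orbitTangent a = Submodule.span ℂ (Set.range fun i => (φ i).velocity a) := by
  simp only [GaAction.orbitTangent_eq, Submodule.span_range_eq_iSup]

/-- The restriction of a tangent vector to the global functions. -/
def onGlobal (a : CPoint X) : TangentSpace a →ₗ[ℂ] (Γ(X, ⊤) →ₗ[ℂ] ℂ) where
  toFun D :=
    { toFun := fun f => D.1 (a.germ f)
      map_add' := fun f g => by rw [map_add, D.2.1]
      map_smul' := fun c f => by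
        rw [Algebra.smul_def, map_mul, D.2.2.1]
        change a.eval (a.germ (constants X c)) * _ + _ * D.1 (a.germ (constants X c)) = c * _
        rw [D.2.2.2, a.eval_germ_constants, mul_zero, add_zero] }
  map_add' _ _ := rfl
  map_smul' _ _ := rfl

lemma onGlobal_injective [X.IsQuasiAffine] (a : CPoint X) : Function.Injective (onGlobal a) :=
  fun _ _ h => TangentSpace.ext_of_isQuasiAffine fun f => congrArg (fun F => F f) h

/-- If the orbits through `a` span its tangent space, finitely many of them span the tangent
spaces at all points near `a`. -/
lemma exists_open_spanning [X.IsQuasiAffine] [Smooth (X ↘ SpecC)] (a : CPoint X)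
    (ha : ⨆ φ : GaAction X, φ.orbitTangent a = ⊤) :
    ∃ (W : X.Opens) (_ : a.pt ∈ W) (d : ℕ) (φ : Fin d → GaAction X),
      ∀ b : CPoint X, b.pt ∈ W → ⨆ i, (φ i).orbitTangent b = ⊤ := by
  obtain ⟨U, hU, haU, d, ⟨β⟩⟩ := exists_basis_kaehler a.pt
  obtain ⟨ea⟩ := exists_tangentSpace_linearEquiv hU β a haU
  rw [iSup_orbitTangent_eq] at ha
  obtain ⟨S, hS, hspan, hli⟩ := exists_linearIndependent ℂ
    (Set.range fun φ : GaAction X => φ.velocity a)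
  rw [ha] at hspan
  let bS : Module.Basis S ℂ (TangentSpace a) := Module.Basis.mk hli (by
    rw [Subtype.range_coe, hspan])
  -- The selected velocities and the basis coming from the differentials both span T_aX, so exactly
  -- d velocities were selected.
  let e : S ≃ Fin d := bS.indexEquiv ((Pi.basisFun ℂ (Fin d)).map ea.symm)
  choose φ hφ using fun i : Fin d => hS (e.symm i).2
  have hind : LinearIndependent ℂ fun i => (φ i).velocity a := by
    have : (fun i => (φ i).velocity a) = (fun s : S => (s : TangentSpace a)) ∘ e.symm :=
      funext hφ
    rw [this]
    exact hli.comp _ e.symm.injective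
  -- Global functions with σ_i(h_j)(a) = δ_ij, so the matrix `M` below is the identity at a.
  obtain ⟨h, hh⟩ := exists_dual_vectors
    (hind.map' (onGlobal a) (LinearMap.ker_eq_bot.2 (onGlobal_injective a)))
  let M : Matrix (Fin d) (Fin d) Γ(X, ⊤) := Matrix.of fun i j => (φ i).field (h j)
  have hM : ∀ (b : CPoint X) i j, (b.eval.comp b.germ).mapMatrix M i j =
      onGlobal b ((φ i).velocity b) (h j) := fun b i j =>
    ((φ i).isValueAt_velocity b (h j)).symm
  refine ⟨X.basicOpen M.det ⊓ U, ⟨?_, haU⟩, d, φ, fun b hb => ?_⟩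
  · refine (X.mem_basicOpen M.det a.pt trivial).2 (isUnit_of_isUnit_eval a ?_)
    change IsUnit ((a.eval.comp a.germ) M.det)
    rw [RingHom.map_det, show (a.eval.comp a.germ).mapMatrix M = 1 from
      Matrix.ext fun i j => (hM a i j).trans (hh i j), Matrix.det_one]
    exact isUnit_one
  · obtain ⟨eb⟩ := exists_tangentSpace_linearEquiv hU β b hb.2
    have hu : IsUnit ((b.eval.comp b.germ) M.det) :=
      ((X.mem_basicOpen M.det b.pt trivial).1 hb.1).map b.eval
    rw [RingHom.map_det] at hu
    have hb : LinearIndependent ℂ fun i => (φ i).velocity b := by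
      rw [Fintype.linearIndependent_iff]
      intro c hc
      refine congrFun (Matrix.eq_zero_of_vecMul_eq_zero hu.ne_zero (funext fun j => ?_))
      have := congrArg (fun D => onGlobal b D (h j)) hc
      simp only [map_sum, map_smul, LinearMap.sum_apply, LinearMap.smul_apply, map_zero,
        LinearMap.zero_apply, smul_eq_mul, ← hM] at this
      exact this
    -- Since b lies in U, T_bX again has dimension d, and d independent vectors span it.
    rw [iSup_orbitTangent_eq]
    have := Module.Finite.equiv eb.symm
    refine hb.span_eq_top_of_card_eq_finrank' ?_
    rw [eb.finrank_eq, Module.finrank_fin_fun, Fintype.card_fin]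

/-- Every nonempty closed subset contains a complex point. -/
lemma exists_cPoint_of_isClosed [CompactSpace X] [LocallyOfFiniteType (X ↘ SpecC)] {Z : Set X}
    (hZ : IsClosed Z) (hne : Z.Nonempty) : ∃ a : CPoint X, a.pt ∈ Z := by
  obtain ⟨x, hx, hcl⟩ := hZ.exists_closed_singleton hne
  refine ⟨⟨pointOfClosedPoint (X ↘ SpecC) x hcl, pointOfClosedPoint_comp _ x hcl⟩, ?_⟩
  exact Set.mem_of_eq_of_mem (pointOfClosedPoint_apply (X ↘ SpecC) x hcl _) hx

lemma exists_finite_spanning [X.IsQuasiAffine] [Smooth (X ↘ SpecC)] (hX : IsFlexible X) :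
    ∃ (l : ℕ) (φ : Fin l → GaAction X), ∀ a : CPoint X, ⨆ i, (φ i).orbitTangent a = ⊤ := by
  choose W hW d φ hφ using fun a : CPoint X => exists_open_spanning a (hX a)
  obtain ⟨t, ht⟩ := isCompact_univ.elim_finite_subcover (fun a => (W a : Set X))
    (fun a => (W a).2) (by
      -- The `W a` are only known to contain the complex points; a nonempty closed complement of
      -- their union would contain one.
      by_contra hne
      obtain ⟨a, ha⟩ := exists_cPoint_of_isClosed
        (isOpen_iUnion fun a => (W a).2).isClosed_compl
        (Set.nonempty_compl.2 fun h => hne h.ge)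
      exact ha (Set.mem_iUnion.2 ⟨a, hW a⟩))
  let e := Fintype.equivFin (Σ a : t, Fin (d a))
  refine ⟨_, fun k => φ (e.symm k).1 (e.symm k).2, fun b => ?_⟩
  obtain ⟨a, hat, hb⟩ := Set.mem_iUnion₂.1 (ht (Set.mem_univ b.pt))
  rw [← top_le_iff, ← hφ a b hb]
  refine iSup_le fun i => ?_
  refine le_iSup_of_le (e ⟨⟨a, hat⟩, i⟩) ?_
  dsimp only
  rw [Equiv.symm_apply_apply]

end Spanning

/-! ### The composite flow as a dominating spray. -/

section Sprays

open AffineSpace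

lemma applyFlow_comp {X : Scheme.{0}} (m : 𝔸(Unit; X) ⟶ X) {T T' : Scheme.{0}} (g : T' ⟶ T) (t : Γ(T, ⊤))
    (x : T ⟶ X) : g ≫ applyFlow m t x = applyFlow m (g.appTop t) (g ≫ x) := by
  rw [applyFlow, ← Category.assoc, comp_homOfVector]
  rfl

variable {X : Scheme.{0}} [X.Over SpecC]

lemma GaAction.applyFlow_over (φ : GaAction X) {T : Scheme.{0}} (t : Γ(T, ⊤)) (x : T ⟶ X) :
    applyFlow φ.hom t x ≫ (X ↘ SpecC) = x ≫ (X ↘ SpecC) := by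
  simp only [applyFlow, Category.assoc, φ.hom_over, homOfVector_over_assoc]

/-- The successive application of flows to a point. -/
def flowList {l : ℕ} (φ : Fin l → GaAction X) {T : Scheme.{0}} (t : Fin l → Γ(T, ⊤))
    (x : T ⟶ X) (L : List (Fin l)) : T ⟶ X :=
  L.foldr (fun i y => applyFlow (φ i).hom (t i) y) x

lemma flowList_over {l : ℕ} (φ : Fin l → GaAction X) {T : Scheme.{0}} (t : Fin l → Γ(T, ⊤))
    (x : T ⟶ X) (L : List (Fin l)) :
    flowList φ t x L ≫ (X ↘ SpecC) = x ≫ (X ↘ SpecC) := by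
  induction L with
  | nil => rfl
  | cons i L ih => exact ((φ i).applyFlow_over _ _).trans ih

lemma comp_flowList {l : ℕ} (φ : Fin l → GaAction X) {T T' : Scheme.{0}} (g : T' ⟶ T)
    (t : Fin l → Γ(T, ⊤)) (x : T ⟶ X) (L : List (Fin l)) :
    g ≫ flowList φ t x L = flowList φ (fun i => g.appTop (t i)) (g ≫ x) L := by
  induction L with
  | nil => rfl
  | cons i L ih =>
    refine (applyFlow_comp _ _ _ _).trans ?_
    rw [show g ≫ List.foldr (fun i y => applyFlow (φ i).hom (t i) y) x L = _ from ih]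
    rfl

lemma flowList_eq_self {l : ℕ} (φ : Fin l → GaAction X) {T : Scheme.{0}} (t : Fin l → Γ(T, ⊤))
    (x : T ⟶ X) (L : List (Fin l)) (h : ∀ i ∈ L, t i = 0) : flowList φ t x L = x := by
  induction L with
  | nil => rfl
  | cons i L ih =>
    change applyFlow (φ i).hom (t i) (flowList φ t x L) = x
    rw [ih fun j hj => h j (List.mem_cons_of_mem _ hj), h i List.mem_cons_self, (φ i).zero_act]

/-- If only the `i`-th time is nonzero, only the `i`-th flow acts. -/
lemma flowList_single {l : ℕ} (φ : Fin l → GaAction X) {T : Scheme.{0}} (i : Fin l) (s : Γ(T, ⊤))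
    (x : T ⟶ X) (L : List (Fin l)) (hL : L.Nodup) (hi : i ∈ L) :
    flowList φ (Pi.single i s) x L = applyFlow (φ i).hom s x := by
  induction L with
  | nil => simp at hi
  | cons j L ih =>
    change applyFlow (φ j).hom ((Pi.single i s : Fin l → Γ(T, ⊤)) j)
      (flowList φ (Pi.single i s) x L) = _
    rw [List.nodup_cons] at hL
    by_cases h : i = j
    · subst h
      rw [Pi.single_eq_same, flowList_eq_self]
      intro k hk
      exact Pi.single_eq_of_ne (by rintro rfl; exact hL.1 hk) _
    · rw [ih hL.2 (by simpa [h] using hi), Pi.single_eq_of_ne (Ne.symm h), (φ j).zero_act]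

/-- Evaluates the composite flow on T-points; both the zero section and the coordinate axes of the
fibres are instances. -/
lemma homOfVector_comp_compositeFlow {l : ℕ} (φ : Fin l → GaAction X) {T : Scheme.{0}}
    (t : Fin l → Γ(T, ⊤)) (x : T ⟶ X) :
    homOfVector x t ≫ compositeFlow φ = flowList φ t x (List.finRange l) := by
  change homOfVector x t ≫ flowList φ (coord X) (𝔸(Fin l; X) ↘ X) _ = _
  rw [comp_flowList, homOfVector_over]
  congr 1
  funext i
  exact homOfVector_appTop_coord x t i

lemma trivialBundle_zero (X : Scheme.{0}) (l : ℕ) :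
    (trivialBundle X l).zero = homOfVector (𝟙 X) (fun _ => 0) := by
  have h := (trivialBundle X l).cover_zero PUnit.unit
  change 𝟙 X ≫ _ = homOfVector (𝟙 X) (fun _ => 0) ≫ 𝟙 _ at h
  exact (Category.id_comp (trivialBundle X l).zero).symm.trans (h.trans (Category.comp_id _))

lemma isSpray_compositeFlow {l : ℕ} (φ : Fin l → GaAction X) :
    IsSpray (trivialBundle X l) (compositeFlow φ) where
  over_base := flowList_over φ (coord X) (𝔸(Fin l; X) ↘ X) _
  zero_comp := by
    rw [trivialBundle_zero]
    refine (homOfVector_comp_compositeFlow φ (fun _ => 0) (𝟙 X)).trans ?_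
    exact flowList_eq_self _ _ _ _ fun _ _ => rfl

/-- The chain rule. -/
lemma differential_comp {X Y Z : Scheme.{0}} [X.Over SpecC] [Y.Over SpecC] [Z.Over SpecC]
    [X.IsQuasiAffine] (f : Y ⟶ X) (hf : f ≫ (X ↘ SpecC) = Y ↘ SpecC) (g : Z ⟶ Y)
    (hg : g ≫ (Y ↘ SpecC) = Z ↘ SpecC) (k : Z ⟶ X) (hk : k ≫ (X ↘ SpecC) = Z ↘ SpecC)
    (hgf : g ≫ f = k) (c : CPoint Z) (b : CPoint Y) (a : CPoint X) (h : c.1 ≫ g = b.1)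
    (h' : b.1 ≫ f = a.1) (h'' : c.1 ≫ k = a.1) (D : TangentSpace c) :
    differential f hf b a h' (differential g hg c b h D) = differential k hk c a h'' D := by
  refine TangentSpace.ext_of_isQuasiAffine fun s => ?_
  change D.1 (localMap g c b h (localMap f b a h' (a.germ s))) = D.1 (localMap k c a h'' (a.germ s))
  rw [localMap_germ, localMap_germ, localMap_germ, ← hgf, Scheme.Hom.comp_appTop]
  rfl

/-- The differential of a constant morphism vanishes. -/
lemma differential_const {X Y : Scheme.{0}} [X.Over SpecC] [Y.Over SpecC] [X.IsQuasiAffine]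
    (a : CPoint X) (b : CPoint Y) (k : Y ⟶ X) (hk : k ≫ (X ↘ SpecC) = Y ↘ SpecC)
    (e : k = (Y ↘ SpecC) ≫ a.1) (h : b.1 ≫ k = a.1) (D : TangentSpace b) :
    differential k hk b a h D = 0 := by
  refine TangentSpace.ext_of_isQuasiAffine fun s => ?_
  change D.1 (localMap k b a h (a.germ s)) = 0
  have hc : k.appTop s =
      constants Y ((Scheme.ΓSpecIso (CommRingCat.of ℂ)).hom (a.1.appTop s)) := by
    rw [e, Scheme.Hom.comp_appTop, constants]
    simp
  rw [localMap_germ, hc, D.2.2.2]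

/-- The velocity of a curve in the fibre over `a` through `0_a` is vertical, so that the velocity
of its image under a spray lies in the image of the vertical tangent space. -/
lemma differential_mem_map_vertical [X.IsQuasiAffine] {E : AlgVectorBundle X} {s : E.total ⟶ X}
    (hs : IsSpray E s) {Z : Scheme.{0}} [Z.Over SpecC] (c : CPoint Z) (a : CPoint X)
    (g : Z ⟶ E.total) (hproj : g ≫ E.proj = (Z ↘ SpecC) ≫ a.1)
    (hzero : c.1 ≫ g = (E.zeroAt a).1) (k : Z ⟶ X) (hk : k ≫ (X ↘ SpecC) = Z ↘ SpecC)
    (hgs : g ≫ s = k) (h : c.1 ≫ k = a.1) (D : TangentSpace c) :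
    differential k hk c a h D ∈ (E.vertical a).map
      (differential s hs.over_base (E.zeroAt a) a (hs.zeroAt_comp a)) := by
  have hover' : ((Z ↘ SpecC) ≫ a.1) ≫ (X ↘ SpecC) = Z ↘ SpecC := by
    rw [Category.assoc, a.2, Category.comp_id]
  have hover : g ≫ (E.total ↘ SpecC) = Z ↘ SpecC := by
    rw [← hover', ← hproj, Category.assoc]
    rfl
  have h0 : c.1 ≫ (Z ↘ SpecC) ≫ a.1 = a.1 := by
    rw [← hproj, ← Category.assoc, hzero, AlgVectorBundle.zeroAt_proj]
  refine ⟨differential g hover c _ hzero D, LinearMap.mem_ker.2 ?_,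
    differential_comp _ _ _ _ _ hk hgs _ _ _ _ _ h D⟩
  exact (differential_comp _ _ _ _ _ hover' hproj _ _ _ _ _ h0 D).trans
    (differential_const a c _ hover' rfl h0 D)

/-- The curve `t ↦ (a, t eᵢ)` in the fibre of the trivial bundle. -/
def fibreLine (a : CPoint X) {l : ℕ} (i : Fin l) :
    𝔸(Unit; SpecC) ⟶ (trivialBundle X l).total :=
  (homOfVector ((𝔸(Unit; SpecC) ↘ SpecC) ≫ a.1) (Pi.single i (coord SpecC ())) :
    𝔸(Unit; SpecC) ⟶ 𝔸(Fin l; X))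

/-- The curve `fibreLine` stays in the fibre over a, and the composite flow carries it to the orbit
of a under the i-th action. -/
lemma orbitTangent_le_map_vertical [X.IsQuasiAffine] {l : ℕ} (φ : Fin l → GaAction X) (a : CPoint X) (i : Fin l) :
    (φ i).orbitTangent a ≤ ((trivialBundle X l).vertical a).map
      (differential (compositeFlow φ) (isSpray_compositeFlow φ).over_base
        ((trivialBundle X l).zeroAt a) a ((isSpray_compositeFlow φ).zeroAt_comp a)) := by
  rintro _ ⟨D, rfl⟩
  have hzero : lineOrigin.1 ≫ fibreLine a i = ((trivialBundle X l).zeroAt a).1 := by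
    change lineOrigin.1 ≫ homOfVector _ _ = a.1 ≫ (trivialBundle X l).zero
    rw [trivialBundle_zero, comp_homOfVector]
    refine Eq.trans ?_ (comp_homOfVector _ _ _).symm
    have h1 : lineOrigin.1 ≫ (𝔸(Unit; SpecC) ↘ SpecC) ≫ a.1 = a.1 := by
      rw [← Category.assoc, show lineOrigin.1 ≫ (𝔸(Unit; SpecC) ↘ SpecC) = 𝟙 SpecC from
        lineOrigin.2, Category.id_comp]
    rw [h1, Category.comp_id]
    congr 1
    funext j
    change lineOrigin.1.appTop _ = a.1.appTop 0
    rw [map_zero]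
    by_cases hj : j = i
    · subst hj
      rw [Pi.single_eq_same]
      exact homOfVector_appTop_coord (𝟙 SpecC) (fun _ => 0) ()
    · rw [Pi.single_eq_of_ne hj, map_zero]
  have hproj : fibreLine a i ≫ (trivialBundle X l).proj = (𝔸(Unit; SpecC) ↘ SpecC) ≫ a.1 :=
    homOfVector_over _ _
  have hflow : fibreLine a i ≫ compositeFlow φ = (φ i).orbit a := by
    refine (homOfVector_comp_compositeFlow φ _ _).trans ?_
    exact flowList_single φ i _ _ _ (List.nodup_finRange l) (List.mem_finRange i)
  exact differential_mem_map_vertical (isSpray_compositeFlow φ) lineOrigin a (fibreLine a i) hproj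
    hzero _ ((φ i).orbit_over a) hflow _ D

lemma isDominatingSpray_compositeFlow [X.IsQuasiAffine] {l : ℕ} (φ : Fin l → GaAction X)
    (h : ∀ a : CPoint X, ⨆ i, (φ i).orbitTangent a = ⊤) :
    IsDominatingSpray (trivialBundle X l) (compositeFlow φ) :=
  ⟨isSpray_compositeFlow φ, fun a => top_le_iff.1 ((h a).ge.trans
    (iSup_le fun i => orbitTangent_le_map_vertical φ a i))⟩

end Sprays

end AlgSpray

end

theorem theorem3p1 (X : Scheme.{0}) [X.Over AlgSpray.SpecC] [X.IsQuasiAffine]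
    [Smooth (X ↘ AlgSpray.SpecC)] (hX : AlgSpray.IsFlexible X) :
    AlgSpray.IsAlgebraicallyElliptic X ∧
      ∃ (l : ℕ) (σ : Fin l → Derivation ℂ Γ(X, ⊤) Γ(X, ⊤)) (φ : Fin l → AlgSpray.GaAction X),
        (∀ i, AlgSpray.IsLocallyNilpotent (σ i)) ∧
        (∀ i, (φ i).IsFlowOf (σ i)) ∧
        AlgSpray.SpanTangentSpaces σ ∧
        AlgSpray.IsDominatingSpray (AlgSpray.trivialBundle X l) (AlgSpray.compositeFlow φ) := by
  obtain ⟨l, φ, hφ⟩ := AlgSpray.exists_finite_spanning hX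
  have hdom := AlgSpray.isDominatingSpray_compositeFlow φ hφ
  refine ⟨⟨_, _, hdom⟩, l, fun i => (φ i).field, φ, fun i => (φ i).isLocallyNilpotent_field,
    fun i => (φ i).isFlowOf_field, fun a => ⟨fun i => (φ i).velocity a,
      fun i => (φ i).isValueAt_velocity a, ?_⟩, hdom⟩
  rw [← AlgSpray.iSup_orbitTangent_eq, hφ]
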